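/- Let $\log$ denote the branch of the complex logarithm on $\mathbb{C}\setminus[0,\infty)$ with $0<\operatorname{Im}\log z<2\pi$ (so its cut is the positive real axis). Let $C$ be any contour, parametrized by a piecewise $C^1$ curve $\gamma:\mathbb{R}\to\mathbb{C}\setminus[0,\infty)$, which comes from $+\infty$ above the cut, goes around the origin counterclockwise, and returns to $+\infty$ below the cut; that is, $\operatorname{Re}\gamma(t)\to+\infty$ and $\operatorname{Im}\gamma(t)/\operatorname{Re}\gamma(t)\to 0$ as $t\to\pm\infty$, with $\operatorname{Im}\gamma(t)>0$ for $t$ near $-\infty$ and $\operatorname{Im}\gamma(t)<0$ for $t$ near $+\infty$. Assume that $C$ does not pass through or enclose any of the poles $\pm i\pi,\pm 2i\pi,\pm 3i\pi,\dots$ of $z/\sinh z$, i.e. its winding number about each of them (the net variation of $\arg(\gamma-w)$, divided by $2\pi$) is $0$. Write $\int_\infty^{(0+)}$ for the integral along $C$. Then for every integer $n\ge 1$ the (improper) integral below converges and $$\zeta(2n+1)=(-1)^{n+1}\,\frac{(2\pi)^{2n}}{2^{2n}-1}\;\frac{1}{2\pi i}\int_{\infty}^{(0+)}\frac{\log z}{z^{2n+1}\sinh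 z}\,\mathrm{d}z .$$ -/

import Mathlib

open Filter Topology

noncomputable section

namespace HankelZeta

/-- The branch of the complex logarithm with the positive real axis as its cut:
off the cut, the imaginary part lies strictly between `0` and `2π`. -/
def cutLog (z : ℂ) : ℂ := Complex.log (-z) + Real.pi * Complex.I

theorem exp_cutLog {z : ℂ} (hz : z ≠ 0) : Complex.exp (cutLog z) = z := by
  rw [cutLog, Complex.exp_add, Complex.exp_log (neg_ne_zero.mpr hz), Complex.exp_pi_mul_I]
  ring

theorem cutLog_im_mem {z : ℂ} (hz : ¬ (0 ≤ z.re ∧ z.im = 0)) :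
    0 < (cutLog z).im ∧ (cutLog z).im < 2 * Real.pi := by
  have h2 : (cutLog z).im = Complex.arg (-z) + Real.pi := by simp [cutLog, Complex.log_im]
  have h3 : Complex.arg (-z) ≠ Real.pi := by
    intro h
    rw [Complex.arg_eq_pi_iff] at h
    simp only [Complex.neg_re, Complex.neg_im] at h
    exact hz ⟨by linarith [h.1], by linarith [h.2]⟩
  have h4 := lt_of_le_of_ne (Complex.arg_le_pi (-z)) h3
  have h5 := Complex.neg_pi_lt_arg (-z)
  rw [h2]
  constructor <;> linarith

/-- A curve `γ : ℝ → ℂ` is piecewise `C¹`: it is continuous and there is a set `S` of break points,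
finitely many in each bounded interval, such that `γ` is `C¹` (one-sidedly at the end points)
on each compact interval with no break point in its interior. -/
def PiecewiseC1 (γ : ℝ → ℂ) : Prop :=
  Continuous γ ∧ ∃ S : Set ℝ, (∀ a b : ℝ, (S ∩ Set.Icc a b).Finite) ∧
    ∀ a b : ℝ, a < b → Disjoint (Set.Ioo a b) S → ContDiffOn ℝ 1 γ (Set.Icc a b)

/-- For a curve `γ` both of whose ends go to infinity in the direction of the positive real axis:
`γ` does not pass through `w` and its winding number about `w` is zero, i.e. a continuous
choice of the argument of `γ - w` which tends to `0` at one end also tends to `0` at the other. -/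
def NotEncloses (γ : ℝ → ℂ) (w : ℂ) : Prop :=
  (∀ t, γ t ≠ w) ∧ ∃ θ : ℝ → ℝ, Continuous θ ∧
    (∀ t, γ t - w = ‖γ t - w‖ * Complex.exp (θ t * Complex.I)) ∧
    Tendsto θ atBot (𝓝 0) ∧ Tendsto θ atTop (𝓝 0)

/-- The contours meant by `∫_∞^{(0+)}`: piecewise `C¹` curves in the plane cut along `[0, ∞)`,
coming from `+∞` above the cut and going back to `+∞` below it (hence passing once
counterclockwise around the origin). -/
structure IsHankelContour (γ : ℝ → ℂ) : Prop where
  piecewiseC1 : PiecewiseC1 γ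
  avoids_cut : ∀ t, ¬ (0 ≤ (γ t).re ∧ (γ t).im = 0)
  re_start : Tendsto (fun t => (γ t).re) atBot atTop
  re_finish : Tendsto (fun t => (γ t).re) atTop atTop
  slope_start : Tendsto (fun t => (γ t).im / (γ t).re) atBot (𝓝 0)
  slope_finish : Tendsto (fun t => (γ t).im / (γ t).re) atTop (𝓝 0)
  start_above : ∀ᶠ t in atBot, 0 < (γ t).im
  finish_below : ∀ᶠ t in atTop, (γ t).im < 0

/-- The integral of `f` along the two-sided infinite curve `γ` converges, with value `J`. -/
def HasContourIntegral (f : ℂ → ℂ) (γ : ℝ → ℂ) (J : ℂ) : Prop :=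
  (∀ a b : ℝ, IntervalIntegrable (fun t => f (γ t) * deriv γ t) MeasureTheory.volume a b) ∧
    Tendsto (fun p : ℝ × ℝ => ∫ t in p.1..p.2, f (γ t) * deriv γ t) (atBot ×ˢ atTop) (𝓝 J)

end HankelZeta

end

/-! The contour is pushed outward, across the poles `iπm`, onto squares of half side `R = π(N +
1/2)`. These run midway between poles, so `sinh` is at least 1 in modulus on their sides, and the
integrand is `O(R⁻²)` there; the sides contribute `O(1/R)`. As the poles lie between `γ` and the
square, the integral is minus `2πi` times the sum of all residues. At `±iπk` the two logarithms
differ by `πi`, so the residues pair up into a multiple of `(-1)^k / k^(2n+1)`, and the alternating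
series gives `ζ(2n+1)`.

No deformation of curves is carried out. On a star-shaped domain containing `γ` and finitely many
poles, the integrand is a holomorphic derivative plus principal parts (`exists_kernel_primitive`),
so it integrates along `γ` to a primitive involving continuous logarithms of `γ - w`
(`PiecewiseC1.integral_eq_sub`). Winding number zero makes these principal at both ends, so only the
primitive's values at the ends of `γ` matter; these are compared round the square in
`norm_integral_add_residues_le`. Convergence comes out of the same estimate as `N → ∞`. -/

namespace HankelZeta

open Set MeasureTheory

/-! ### Primitives and principal parts -/

/-- A holomorphic function on an open star-shaped set has a primitive. -/
theorem exists_primitive_of_starConvex {U : Set ℂ} {a : ℂ} (hU : IsOpen U)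
    (hs : StarConvex ℝ a U) {g : ℂ → ℂ} (hg : DifferentiableOn ℂ g U) :
    ∃ G : ℂ → ℂ, ∀ z ∈ U, HasDerivAt G (g z) z := by
  let ω : ℂ → ℂ →L[ℂ] ℂ := fun z => ContinuousLinearMap.smulRightL ℂ ℂ ℂ 1 (g z)
  refine ⟨fun z => curveIntegral ω (Path.segment a z), fun z hz => ?_⟩
  have hseg : segment ℝ a z ⊆ U := hs.segment_subset hz
  have hcomp : IsCompact (segment ℝ a z) := by
    rw [segment_eq_image]
    exact isCompact_Icc.image (by fun_prop)
  -- The Poincaré lemma is applied on a convex set; a thickening of the segment is convex and still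
  -- inside `U`.
  obtain ⟨δ, hδ, hsub⟩ := hcomp.exists_thickening_subset_open hU hseg
  have hconv : Convex ℝ (Metric.thickening δ (segment ℝ a z)) := (convex_segment a z).thickening δ
  have hmem : segment ℝ a z ⊆ Metric.thickening δ (segment ℝ a z) :=
    Metric.self_subset_thickening hδ _
  have key := hconv.hasFDerivWithinAt_curveIntegral_segment_of_hasFDerivWithinAt_symmetric
    (ω := ω) (𝕜 := ℂ)
    (dω := fun x => ((ContinuousLinearMap.smulRightL ℂ ℂ ℂ 1).comp
      ((1 : ℂ →L[ℂ] ℂ).smulRight (deriv g x))).restrictScalars ℝ)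
    (fun x hx => by
      have h1 : HasDerivAt g (deriv g x) x :=
        (hg.differentiableAt (hU.mem_nhds (hsub hx))).hasDerivAt
      exact (((ContinuousLinearMap.smulRightL ℂ ℂ ℂ 1).hasFDerivAt.comp x
        h1.hasFDerivAt).restrictScalars ℝ).hasFDerivWithinAt)
    -- Closedness of `g dz`: the bilinear form `g'(x) u v` is symmetric in `u` and `v`.
    (by
      rintro x - u - v -
      simp
      ring)
    (hmem (left_mem_segment ℝ a z)) (hmem (right_mem_segment ℝ a z))
  exact key.hasFDerivAt (Metric.isOpen_thickening.mem_nhds (hmem (right_mem_segment ℝ a z)))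

/-- A function with finitely many simple poles in an open set is the sum of its
principal parts and a holomorphic function. -/
theorem exists_principalPart_decomposition {U : Set ℂ} (hU : IsOpen U) (r : ℂ → ℂ)
    (K : Finset ℂ) : ∀ f : ℂ → ℂ, DifferentiableOn ℂ f (U \ K) → (↑K ⊆ U) →
    (∀ w ∈ K, Tendsto (fun z => (z - w) * f z) (𝓝[≠] w) (𝓝 (r w))) →
    ∃ g : ℂ → ℂ, DifferentiableOn ℂ g U ∧
      ∀ z ∈ U \ K, f z = g z + ∑ w ∈ K, r w * (z - w)⁻¹ := by
  classical
  induction K using Finset.induction_on with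
  | empty => exact fun f hf _ _ => ⟨f, by simpa using hf, by simp⟩
  | insert w K hw ih =>
    intro f hf hKU hlim
    have hwU : w ∈ U := hKU (by simp)
    have hUK : U \ K ∈ 𝓝 w :=
      (hU.sdiff K.finite_toSet.isClosed).mem_nhds ⟨hwU, by simpa using hw⟩
    let h : ℂ → ℂ := fun z => f z - r w * (z - w)⁻¹
    have hd : DifferentiableOn ℂ h ((U \ K) \ {w}) := by
      intro z hz
      have hzw : z - w ≠ 0 := sub_ne_zero.mpr (by simpa using hz.2)
      refine (((hf z ?_).mono ?_).sub (DifferentiableAt.differentiableWithinAt ?_))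
      · simp only [Set.mem_sdiff, Finset.coe_insert, mem_insert_iff] at hz ⊢
        exact ⟨hz.1.1, by rintro (h | h); exacts [hz.2 h, hz.1.2 h]⟩
      · intro y hy
        simp only [Set.mem_sdiff, Finset.coe_insert, mem_insert_iff] at hy ⊢
        exact ⟨hy.1.1, by rintro (h | h); exacts [hy.2 h, hy.1.2 h]⟩
      · fun_prop (disch := assumption)
    -- Removable singularity criterion: after subtraction of the principal part, `(z - w) h z → 0`.
    have ho : (fun z => h z - h w) =o[𝓝[≠] w] fun z => (z - w)⁻¹ := by
      rw [Asymptotics.isLittleO_iff_tendsto']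
      · have h1 := hlim w (by simp)
        have h2 : Tendsto (fun z => (z - w) * f z - r w - (z - w) * h w) (𝓝[≠] w)
            (𝓝 (r w - r w - 0 * h w)) := by
          refine (h1.sub tendsto_const_nhds).sub (Tendsto.mul_const _ ?_)
          have : Tendsto (fun z : ℂ => z - w) (𝓝 w) (𝓝 (w - w)) := by
            exact (continuous_id.sub continuous_const).tendsto w
          rw [sub_self] at this
          exact this.mono_left nhdsWithin_le_nhds
        simp only [sub_self, zero_mul] at h2
        refine h2.congr' ?_
        filter_upwards [self_mem_nhdsWithin] with z hz
        have hzw : z - w ≠ 0 := sub_ne_zero.mpr hz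
        simp only [h]
        field_simp
      · filter_upwards [self_mem_nhdsWithin] with z hz h0
        exact absurd h0 (inv_ne_zero (sub_ne_zero.mpr hz))
    have hf1 := Complex.differentiableOn_update_limUnder_of_isLittleO hUK hd ho
    set f1 := Function.update h w (limUnder (𝓝[≠] w) h) with hf1def
    obtain ⟨g, hg, hgf⟩ := ih f1 hf1 (fun z hz => hKU (by simp_all)) (by
      intro v hv
      have hvw : v ≠ w := fun e => hw (e ▸ hv)
      have h1 := hlim v (by simp [hv])
      have h2 : Tendsto (fun z => (z - v) * (r w * (z - w)⁻¹)) (𝓝 v)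
          (𝓝 ((v - v) * (r w * (v - w)⁻¹))) := by
        have : v - w ≠ 0 := sub_ne_zero.mpr hvw
        refine ContinuousAt.tendsto (f := fun z => (z - v) * (r w * (z - w)⁻¹)) ?_
        fun_prop (disch := assumption)
      have h3 := h1.sub (h2.mono_left nhdsWithin_le_nhds)
      simp only [sub_self, zero_mul, sub_zero] at h3
      refine h3.congr' ?_
      filter_upwards [nhdsWithin_le_nhds (isOpen_ne.mem_nhds hvw)] with z hz
      simp only [hf1def, Function.update_of_ne (show z ≠ w from hz), h]
      ring)
    refine ⟨g, hg, fun z hz => ?_⟩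
    simp only [Finset.coe_insert, Set.mem_sdiff, mem_insert_iff, not_or] at hz
    have := hgf z ⟨hz.1, hz.2.2⟩
    rw [hf1def, Function.update_of_ne hz.2.1] at this
    rw [Finset.sum_insert hw]
    linear_combination this

/-! ### Integration along piecewise `C¹` curves -/

theorem exists_Ioo_inter_subset_singleton {S : Set ℝ} (hfin : ∀ a b : ℝ, (S ∩ Icc a b).Finite)
    (t : ℝ) : ∃ δ > 0, ∀ x ∈ Ioo (t - δ) (t + δ), x ≠ t → x ∉ S := by
  have hcl : IsClosed ((S ∩ Icc (t - 1) (t + 1)) \ {t}) :=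
    ((hfin _ _).subset sdiff_subset).isClosed
  obtain ⟨ε, hε, hball⟩ := Metric.isOpen_iff.1 hcl.isOpen_compl t (by simp)
  refine ⟨min ε 1, lt_min hε one_pos, fun x hx hxt hxS => ?_⟩
  have h1 : |x - t| < min ε 1 := by rw [abs_lt]; constructor <;> linarith [hx.1, hx.2]
  have h2 := hball (show x ∈ Metric.ball t ε from h1.trans_le (min_le_left _ _))
  have h3 := abs_lt.1 (h1.trans_le (min_le_right _ _))
  exact h2 ⟨⟨hxS, by constructor <;> linarith⟩, hxt⟩

theorem PiecewiseC1.locallyIntegrable_deriv {γ : ℝ → ℂ} (hγ : PiecewiseC1 γ) :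
    LocallyIntegrable (deriv γ) := by
  obtain ⟨-, S, hfin, hS⟩ := hγ
  have one_side : ∀ a b : ℝ, a < b → Disjoint (Ioo a b) S → IntegrableOn (deriv γ) (Ioo a b) := by
    intro a b hab hd
    have h1 : ContinuousOn (derivWithin γ (Icc a b)) (Icc a b) :=
      (hS a b hab hd).continuousOn_derivWithin (uniqueDiffOn_Icc hab) le_rfl
    refine ((h1.integrableOn_compact isCompact_Icc).mono_set Ioo_subset_Icc_self).congr_fun
      (fun x hx => ?_) measurableSet_Ioo
    exact derivWithin_of_mem_nhds (Icc_mem_nhds hx.1 hx.2)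
  intro t
  obtain ⟨δ, hδ, hmem⟩ := exists_Ioo_inter_subset_singleton hfin t
  refine ⟨Ioo (t - δ) (t + δ), Ioo_mem_nhds (by linarith) (by linarith), ?_⟩
  have hl := one_side (t - δ) t (by linarith) (disjoint_left.2 fun x hx =>
    hmem x ⟨hx.1, by linarith [hx.2]⟩ hx.2.ne)
  have hr := one_side t (t + δ) (by linarith) (disjoint_left.2 fun x hx =>
    hmem x ⟨by linarith [hx.1], hx.2⟩ hx.1.ne')
  -- At a possible break point the value of `deriv γ` carries no information, but one point is null.
  have hm : IntegrableOn (deriv γ) {t} := by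
    rw [← Icc_self, integrableOn_Icc_iff_integrableOn_Ioo]
    simp
  refine ((hl.union hm).union hr).mono_set fun x hx => ?_
  rcases lt_trichotomy x t with h | h | h
  · exact Or.inl (Or.inl ⟨hx.1, h⟩)
  · exact Or.inl (Or.inr h)
  · exact Or.inr ⟨h, hx.2⟩

theorem PiecewiseC1.exists_countable_differentiableAt {γ : ℝ → ℂ} (hγ : PiecewiseC1 γ) :
    ∃ S : Set ℝ, S.Countable ∧ ∀ t ∉ S, DifferentiableAt ℝ γ t := by
  obtain ⟨-, S, hfin, hS⟩ := hγ
  refine ⟨S, ?_, fun t ht => ?_⟩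
  · have : S = ⋃ n : ℕ, S ∩ Icc (-n : ℝ) n := by
      ext x
      obtain ⟨n, hn⟩ := exists_nat_ge |x|
      simp only [mem_iUnion, mem_inter_iff, exists_and_left]
      exact ⟨fun h => ⟨h, n, abs_le.1 hn⟩, fun h => h.1⟩
    rw [this]
    exact countable_iUnion fun n => (hfin _ _).countable
  · obtain ⟨δ, hδ, hmem⟩ := exists_Ioo_inter_subset_singleton hfin t
    have hdis : Disjoint (Ioo (t - δ) (t + δ)) S := disjoint_left.2 fun x hx hxS =>
      hmem x hx (fun e => ht (e ▸ hxS)) hxS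
    exact ((hS _ _ (by linarith) hdis).differentiableOn one_ne_zero).differentiableAt
      (Icc_mem_nhds (by linarith) (by linarith))

/-- A continuous logarithm along a curve has the logarithmic derivative as its derivative. -/
theorem hasDerivAt_of_exp_eq {ℓ c : ℝ → ℂ} {c' : ℂ} {t : ℝ} (hℓ : Continuous ℓ)
    (hexp : ∀ s, Complex.exp (ℓ s) = c s) (hc : HasDerivAt c c' t) :
    HasDerivAt ℓ (c' / c t) t := by
  have hne : c t ≠ 0 := hexp t ▸ Complex.exp_ne_zero _
  have h1 : HasDerivAt (fun s => ℓ t + Complex.log (c s / c t)) (0 + c' / c t / (c t / c t)) t := by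
    refine (hasDerivAt_const t _).add ((hc.div_const (c t)).clog_real ?_)
    simp [hne]
  rw [div_self hne, div_one, zero_add] at h1
  refine h1.congr_of_eventuallyEq ?_
  -- Near `t` the imaginary part of `ℓ s - ℓ t` stays in `(-π, π)`, so the principal logarithm of `c
  -- s / c t` recovers it.
  have h2 : Tendsto (fun s => (ℓ s - ℓ t).im) (𝓝 t) (𝓝 0) := by
    have : Continuous fun s => (ℓ s - ℓ t).im := by fun_prop
    simpa using this.tendsto t
  filter_upwards [h2 (Ioo_mem_nhds (neg_lt_zero.2 Real.pi_pos) Real.pi_pos)] with s hs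
  rw [← hexp s, ← hexp t, ← Complex.exp_sub, Complex.log_exp hs.1 hs.2.le]
  ring

/-- The fundamental theorem of calculus along a piecewise `C¹` curve, for a function whose
primitive is the sum of a single-valued part and finitely many logarithms. -/
theorem PiecewiseC1.integral_eq_sub {γ : ℝ → ℂ} (hγ : PiecewiseC1 γ) {U : Set ℂ} (hU : IsOpen U)
    (hγU : ∀ t, γ t ∈ U) {K : Finset ℂ} {f g G r : ℂ → ℂ} (hf : DifferentiableOn ℂ f (U \ K))
    (hG : ∀ z ∈ U, HasDerivAt G (g z) z)
    (hfg : ∀ z ∈ U \ K, f z = g z + ∑ w ∈ K, r w * (z - w)⁻¹) {ℓ : ℂ → ℝ → ℂ}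
    (hℓ : ∀ w ∈ K, Continuous (ℓ w)) (hexp : ∀ w ∈ K, ∀ t, Complex.exp (ℓ w t) = γ t - w)
    (a b : ℝ) :
    IntervalIntegrable (fun t => f (γ t) * deriv γ t) volume a b ∧
      ∫ t in a..b, f (γ t) * deriv γ t =
        (G (γ b) + ∑ w ∈ K, r w * ℓ w b) - (G (γ a) + ∑ w ∈ K, r w * ℓ w a) := by
  have hγK : ∀ t, γ t ∈ U \ K := fun t => ⟨hγU t, fun h => by
    have := hexp _ h t
    rw [sub_self] at this
    exact Complex.exp_ne_zero _ this⟩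
  have hUK : IsOpen (U \ K) := hU.sdiff K.finite_toSet.isClosed
  have hint : IntervalIntegrable (fun t => f (γ t) * deriv γ t) volume a b := by
    have h1 : IntervalIntegrable (deriv γ) volume a b :=
      (hγ.locallyIntegrable_deriv.integrableOn_isCompact isCompact_uIcc).intervalIntegrable
    exact h1.continuousOn_mul (hf.continuousOn.comp_continuous hγ.1 hγK).continuousOn
  refine ⟨hint, ?_⟩
  obtain ⟨S, hS, hd⟩ := hγ.exists_countable_differentiableAt
  have hGc : Continuous fun t => G (γ t) :=
    ContinuousOn.comp_continuous (fun z hz => (hG z hz).continuousAt.continuousWithinAt) hγ.1 hγU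
  refine integral_eq_of_hasDerivAt_off_countable
    (fun t => G (γ t) + ∑ w ∈ K, r w * ℓ w t) _ hS ?_ (fun t ht => ?_) hint
  · exact (hGc.add (continuous_finsetSum _ fun w hw => continuous_const.mul (hℓ w hw))).continuousOn
  · have h1 : HasDerivAt γ (deriv γ t) t := (hd t ht.2).hasDerivAt
    have h2 := (hG _ (hγU t)).comp t h1
    have h3 : HasDerivAt (fun t => ∑ w ∈ K, r w * ℓ w t)
        (∑ w ∈ K, r w * (deriv γ t / (γ t - w))) t := HasDerivAt.fun_sum fun w hw =>
      (hasDerivAt_of_exp_eq (c := fun s => γ s - w) (hℓ w hw) (hexp w hw)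
        (h1.sub_const w)).const_mul (r w)
    refine (h2.add h3).congr_deriv ?_
    rw [hfg _ (hγK t), add_mul, Finset.sum_mul]
    congr 1
    exact Finset.sum_congr rfl fun w _ => by ring

/-- A curve which does not enclose `w` has a continuous logarithm of `γ - w`, which is the
principal one near both ends. -/
theorem NotEncloses.exists_log {γ : ℝ → ℂ} {w : ℂ} (h : NotEncloses γ w) (hγ : Continuous γ) :
    ∃ ℓ : ℝ → ℂ, Continuous ℓ ∧ (∀ t, Complex.exp (ℓ t) = γ t - w) ∧
      (∀ᶠ t in atBot, ℓ t = Complex.log (γ t - w)) ∧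
      (∀ᶠ t in atTop, ℓ t = Complex.log (γ t - w)) := by
  obtain ⟨hne, θ, hθ, hexp, hbot, htop⟩ := h
  have hne' : ∀ t, γ t - w ≠ 0 := fun t => sub_ne_zero.mpr (hne t)
  have key : ∀ t, Complex.exp (Real.log ‖γ t - w‖ + θ t * Complex.I) = γ t - w := fun t => by
    rw [Complex.exp_add, ← Complex.ofReal_exp, Real.exp_log (norm_pos_iff.2 (hne' t)), ← hexp t]
  have hlog : ∀ t, θ t ∈ Ioo (-Real.pi) Real.pi →
      Real.log ‖γ t - w‖ + θ t * Complex.I = Complex.log (γ t - w) := fun t ht => by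
    rw [← key t, Complex.log_exp (by simpa using ht.1) (by simpa using ht.2.le), key t]
  have hnhds : Ioo (-Real.pi) Real.pi ∈ 𝓝 (0 : ℝ) :=
    Ioo_mem_nhds (neg_lt_zero.2 Real.pi_pos) Real.pi_pos
  refine ⟨fun t => Real.log ‖γ t - w‖ + θ t * Complex.I, ?_, key, ?_, ?_⟩
  · have : Continuous fun t => Real.log ‖γ t - w‖ :=
      (hγ.sub continuous_const).norm.log fun t => norm_ne_zero_iff.2 (hne' t)
    fun_prop
  · filter_upwards [hbot hnhds] with t ht using hlog t ht
  · filter_upwards [htop hnhds] with t ht using hlog t ht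

/-! ### Branches of the logarithm; zeros and lower bounds of `sinh` -/

theorem _root_.Complex.log_neg_of_im_pos {u : ℂ} (hu : 0 < u.im) :
    Complex.log (-u) = Complex.log u - Real.pi * Complex.I := by
  apply Complex.ext <;>
    simp [Complex.log_re, Complex.log_im, Complex.arg_neg_eq_arg_sub_pi_of_im_pos hu]

theorem _root_.Complex.log_neg_of_im_neg {u : ℂ} (hu : u.im < 0) :
    Complex.log (-u) = Complex.log u + Real.pi * Complex.I := by
  apply Complex.ext <;>
    simp [Complex.log_re, Complex.log_im, Complex.arg_neg_eq_arg_add_pi_of_im_neg hu]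

theorem _root_.Complex.sinh_eq_zero_iff_exists_int {z : ℂ} :
    Complex.sinh z = 0 ↔ ∃ m : ℤ, z = m * Real.pi * Complex.I := by
  have h : Complex.sin (z * Complex.I) = Complex.sinh z * Complex.I := Complex.sin_mul_I z
  have h1 : Complex.sinh z = 0 ↔ Complex.sin (z * Complex.I) = 0 := by simp [h]
  rw [h1, Complex.sin_eq_zero_iff]
  constructor
  · rintro ⟨k, hk⟩
    refine ⟨-k, ?_⟩
    push_cast
    linear_combination (-Complex.I) * hk + z * Complex.I_mul_I
  · rintro ⟨m, rfl⟩
    refine ⟨-m, ?_⟩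
    push_cast
    linear_combination (m * Real.pi : ℂ) * Complex.I_mul_I

theorem one_le_norm_sinh_of_one_le_abs_re {z : ℂ} (hz : 1 ≤ |z.re|) : 1 ≤ ‖Complex.sinh z‖ := by
  have h1 : ∀ x : ℝ, 1 ≤ x → 1 ≤ (Real.exp x - Real.exp (-x)) / 2 := fun x hx => by
    rw [← Real.sinh_eq]
    exact hx.trans (Real.self_le_sinh_iff.2 (by linarith))
  have h2 : ‖Complex.sinh z‖ = ‖Complex.exp z - Complex.exp (-z)‖ / 2 := by
    rw [Complex.sinh, norm_div]; simp
  have h3 : |Real.exp z.re - Real.exp (-z.re)| ≤ ‖Complex.exp z - Complex.exp (-z)‖ := by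
    have := abs_norm_sub_norm_le (Complex.exp z) (Complex.exp (-z))
    simpa [Complex.norm_exp] using this
  rw [h2]
  rcases le_abs.1 hz with h | h
  · have := h1 _ h
    have := le_abs_self (Real.exp z.re - Real.exp (-z.re))
    linarith
  · have := h1 _ h
    rw [neg_neg] at this
    have := neg_le_abs (Real.exp z.re - Real.exp (-z.re))
    linarith

/-- Here `sinh z` is purely imaginary, with modulus `cosh (re z)`. -/
theorem one_le_norm_sinh_of_cos_im_eq_zero {z : ℂ} (hz : Real.cos z.im = 0) :
    1 ≤ ‖Complex.sinh z‖ := by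
  have hs : |Real.sin z.im| = 1 := by
    have := Real.sin_sq_add_cos_sq z.im
    rw [hz] at this
    rw [← sq_eq_sq₀ (abs_nonneg _) one_pos.le, sq_abs]
    linarith
  have h1 : (Complex.sinh z).im = Real.cosh z.re * Real.sin z.im := by
    conv_lhs => rw [← Complex.re_add_im z]
    rw [Complex.sinh_add, Complex.sinh_mul_I, Complex.cosh_mul_I, ← Complex.ofReal_cos, hz,
      ← Complex.ofReal_cosh, ← Complex.ofReal_sin, Complex.ofReal_zero, mul_zero,
      zero_add, ← mul_assoc, ← Complex.ofReal_mul, Complex.mul_I_im, Complex.ofReal_re]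
  refine le_trans ?_ (Complex.abs_im_le_norm _)
  rw [h1, abs_mul, hs, mul_one]
  exact (Real.one_le_cosh _).trans (le_abs_self _)

/-! ### The integrand, its domain and its poles -/

/-- The integrand of the contour integral. -/
noncomputable def kernel (n : ℕ) (z : ℂ) : ℂ :=
  cutLog z / (z ^ (2 * n + 1) * Complex.sinh z)

/-- The residue of the integrand at a zero `w ≠ 0` of `sinh`. -/
noncomputable def kernelResidue (n : ℕ) (w : ℂ) : ℂ :=
  cutLog w / (w ^ (2 * n + 1) * Complex.cosh w)

/-- The plane cut along `[0, ∞)`, without a part containing the poles `iπm` with `N < |m|`. -/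
def cutDomain (N : ℕ) : Set ℂ :=
  {z | ¬ (0 ≤ z.re ∧ z.im = 0) ∧ |z.im| < Real.pi * (N + 1) + max 0 z.re}

/-- The poles `iπm` with `0 < |m| ≤ N`. -/
noncomputable def poles (N : ℕ) : Finset ℂ :=
  ((Finset.Icc (-N : ℤ) N).erase 0).image fun m : ℤ => (m * Real.pi * Complex.I : ℂ)

theorem mem_poles {N : ℕ} {w : ℂ} :
    w ∈ poles N ↔ ∃ m : ℤ, m ≠ 0 ∧ |m| ≤ N ∧ w = m * Real.pi * Complex.I := by
  simp [poles, abs_le, and_assoc, eq_comm]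

theorem re_of_mem_poles {N : ℕ} {w : ℂ} (hw : w ∈ poles N) : w.re = 0 := by
  obtain ⟨m, -, -, rfl⟩ := mem_poles.1 hw
  simp

theorem im_ne_zero_of_mem_poles {N : ℕ} {w : ℂ} (hw : w ∈ poles N) : w.im ≠ 0 := by
  obtain ⟨m, hm, -, rfl⟩ := mem_poles.1 hw
  simp [hm, Real.pi_ne_zero]

theorem abs_im_le_of_mem_poles {N : ℕ} {w : ℂ} (hw : w ∈ poles N) : |w.im| ≤ Real.pi * N := by
  obtain ⟨m, -, hm, rfl⟩ := mem_poles.1 hw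
  have h1 : |(m : ℝ)| ≤ N := by exact_mod_cast hm
  have h2 : ((m : ℂ) * Real.pi * Complex.I).im = m * Real.pi := by simp
  rw [h2, abs_mul, abs_of_pos Real.pi_pos, mul_comm]
  exact mul_le_mul_of_nonneg_left h1 Real.pi_pos.le

theorem ne_zero_of_not_mem_cut {z : ℂ} (hz : ¬ (0 ≤ z.re ∧ z.im = 0)) : z ≠ 0 := by
  rintro rfl
  simp at hz

theorem poles_subset_cutDomain (N : ℕ) : (poles N : Set ℂ) ⊆ cutDomain N := fun w hw => by
  refine ⟨fun h => im_ne_zero_of_mem_poles hw h.2, ?_⟩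
  have := abs_im_le_of_mem_poles hw
  have := le_max_left 0 w.re
  nlinarith [Real.pi_pos]

theorem isOpen_cutDomain (N : ℕ) : IsOpen (cutDomain N) := by
  have h1 : IsClosed {z : ℂ | 0 ≤ z.re ∧ z.im = 0} :=
    (isClosed_le continuous_const Complex.continuous_re).inter
      (isClosed_eq Complex.continuous_im continuous_const)
  refine h1.isOpen_compl.inter (isOpen_lt (f := fun z : ℂ => |z.im|)
    (g := fun z : ℂ => Real.pi * (N + 1) + max 0 z.re) (by fun_prop) (by fun_prop))

theorem starConvex_cutDomain (N : ℕ) : StarConvex ℝ (-1 : ℂ) (cutDomain N) := by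
  intro z hz a b ha hb hab
  have hre : (a • (-1 : ℂ) + b • z).re = -a + b * z.re := by simp
  have him : (a • (-1 : ℂ) + b • z).im = b * z.im := by simp
  refine ⟨?_, ?_⟩
  · rw [hre, him]
    rintro ⟨h1, h2⟩
    rcases mul_eq_zero.1 h2 with rfl | h3
    · linarith
    · refine hz.1 ⟨?_, h3⟩
      by_contra! h4
      have h5 : b * z.re ≤ 0 := mul_nonpos_of_nonneg_of_nonpos hb h4.le
      have h6 : b = 1 := by linarith
      rw [h6] at h1
      linarith
  · rw [hre, him, abs_mul, abs_of_nonneg hb]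
    have h1 := hz.2
    -- Moving towards `-1` shifts the real part by `-a`, while the constant part of the height bound
    -- scales by `1 - a`; the slack `a * (π * (N + 1))` covers the shift once the constant is at
    -- least 1.
    have hA : 1 ≤ Real.pi * (N + 1) := by
      have := Real.pi_gt_three
      have : (0 : ℝ) ≤ N := N.cast_nonneg
      nlinarith
    rcases hb.eq_or_lt with rfl | hb'
    · have := le_max_left 0 (-a + 0 * z.re)
      linarith
    have h2 : b * |z.im| < b * (Real.pi * (N + 1) + max 0 z.re) := mul_lt_mul_of_pos_left h1 hb'
    rcases le_total 0 z.re with h | h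
    · rw [max_eq_right h] at h2
      have := le_max_right 0 (-a + b * z.re)
      nlinarith
    · rw [max_eq_left h] at h2
      have := le_max_left 0 (-a + b * z.re)
      nlinarith

theorem differentiableAt_cutLog {z : ℂ} (hz : ¬ (0 ≤ z.re ∧ z.im = 0)) :
    DifferentiableAt ℂ cutLog z := by
  refine (differentiableAt_id.neg.clog ?_).add_const _
  rw [Complex.mem_slitPlane_iff]
  change 0 < -z.re ∨ -z.im ≠ 0
  by_contra! h
  exact hz ⟨by linarith, by linarith⟩

theorem sinh_ne_zero_of_mem_cutDomain {N : ℕ} {z : ℂ} (hz : z ∈ cutDomain N)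
    (hp : z ∉ poles N) : Complex.sinh z ≠ 0 := by
  intro h
  obtain ⟨m, rfl⟩ := Complex.sinh_eq_zero_iff_exists_int.1 h
  refine hp (mem_poles.2 ⟨m, ?_, ?_, rfl⟩)
  · rintro rfl
    simpa using ne_zero_of_not_mem_cut hz.1
  · have h2 := hz.2
    have h3 : ((m : ℂ) * Real.pi * Complex.I).im = m * Real.pi := by simp
    have h4 : ((m : ℂ) * Real.pi * Complex.I).re = 0 := by simp
    rw [h3, h4, max_self, add_zero, abs_mul, abs_of_pos Real.pi_pos, mul_comm] at h2
    have h5 := lt_of_mul_lt_mul_left h2 Real.pi_pos.le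
    have h6 : |m| < (N : ℤ) + 1 := by exact_mod_cast h5
    omega

theorem differentiableOn_kernel (n N : ℕ) :
    DifferentiableOn ℂ (kernel n) (cutDomain N \ poles N) := fun z hz => by
  have h0 := ne_zero_of_not_mem_cut hz.1.1
  have h1 := sinh_ne_zero_of_mem_cutDomain hz.1 hz.2
  refine DifferentiableAt.differentiableWithinAt ?_
  exact (differentiableAt_cutLog hz.1.1).div (by fun_prop) (mul_ne_zero (pow_ne_zero _ h0) h1)

theorem tendsto_sub_mul_kernel (n : ℕ) {N : ℕ} {w : ℂ} (hw : w ∈ poles N) :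
    Tendsto (fun z => (z - w) * kernel n z) (𝓝[≠] w) (𝓝 (kernelResidue n w)) := by
  have hcut := (poles_subset_cutDomain N hw).1
  have hw0 := ne_zero_of_not_mem_cut hcut
  have hsinh : Complex.sinh w = 0 := by
    obtain ⟨m, -, -, h⟩ := mem_poles.1 hw
    exact Complex.sinh_eq_zero_iff_exists_int.2 ⟨m, h⟩
  have hcosh : Complex.cosh w ≠ 0 := fun h => by
    have := Complex.cosh_sq_sub_sinh_sq w
    simp [h, hsinh] at this
  have h1 : Tendsto (fun z => (slope Complex.sinh w z)⁻¹) (𝓝[≠] w) (𝓝 (Complex.cosh w)⁻¹) :=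
    ((hasDerivAt_iff_tendsto_slope.1 (Complex.hasDerivAt_sinh w)).inv₀ hcosh)
  have h2 : Tendsto (fun z => cutLog z / z ^ (2 * n + 1)) (𝓝[≠] w)
      (𝓝 (cutLog w / w ^ (2 * n + 1))) :=
    ((differentiableAt_cutLog hcut).continuousAt.div (continuous_pow _).continuousAt
      (pow_ne_zero _ hw0)).tendsto.mono_left nhdsWithin_le_nhds
  have h3 := h2.mul h1
  rw [← div_eq_mul_inv, div_div] at h3
  refine h3.congr fun z => ?_
  rw [slope_def_field, hsinh, sub_zero, kernel, inv_div]
  simp only [div_eq_mul_inv, mul_inv]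
  ring

/-- The constant comes from `log ‖z‖ + 2π ≤ (1 + 2π) ‖z‖`. -/
theorem norm_cutLog_le {z : ℂ} (hz : 1 ≤ ‖z‖) : ‖cutLog z‖ ≤ 8 * ‖z‖ := by
  have h1 : ‖Complex.log (-z)‖ ≤ |Real.log ‖z‖| + Real.pi := by
    refine (Complex.norm_le_abs_re_add_abs_im _).trans (add_le_add ?_ ?_)
    · rw [Complex.log_re, norm_neg]
    · rw [Complex.log_im]; exact Complex.abs_arg_le_pi _
  have h2 : |Real.log ‖z‖| ≤ ‖z‖ := by
    rw [abs_of_nonneg (Real.log_nonneg hz)]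
    exact (Real.log_le_sub_one_of_pos (by linarith)).trans (by linarith)
  have h3 : ‖(Real.pi * Complex.I : ℂ)‖ = Real.pi := by simp [abs_of_pos Real.pi_pos]
  have h4 := norm_add_le (Complex.log (-z)) (Real.pi * Complex.I)
  rw [cutLog]
  linarith [Real.pi_lt_d2]

/-- One factor of `z ^ (2 * n + 1)` absorbs the logarithm; `n ≥ 1` leaves at least two more, enough
to beat paths of length `O(c)`. -/
theorem norm_kernel_le {n : ℕ} (hn : 1 ≤ n) {z : ℂ} {c : ℝ} (hc : 1 ≤ c) (hz : c ≤ ‖z‖)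
    (hs : 1 ≤ ‖Complex.sinh z‖) : ‖kernel n z‖ ≤ 8 / c ^ 2 := by
  have hz1 : 1 ≤ ‖z‖ := hc.trans hz
  have h1 : ‖z‖ * c ^ 2 ≤ ‖z‖ ^ (2 * n + 1) * ‖Complex.sinh z‖ := by
    have h2 : ‖z‖ ^ 3 ≤ ‖z‖ ^ (2 * n + 1) := pow_le_pow_right₀ hz1 (by omega)
    have h3 : c ^ 2 ≤ ‖z‖ ^ 2 := by gcongr
    have h4 : 0 ≤ ‖z‖ ^ (2 * n + 1) := by positivity
    nlinarith
  rw [kernel, norm_div, norm_mul, norm_pow]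
  rw [div_le_div_iff₀ (by positivity) (by positivity)]
  have := norm_cutLog_le hz1
  calc ‖cutLog z‖ * c ^ 2 ≤ 8 * ‖z‖ * c ^ 2 := by gcongr
    _ = 8 * (‖z‖ * c ^ 2) := by ring
    _ ≤ _ := by gcongr

theorem _root_.Convex.reProdIm {s t : Set ℝ} (hs : Convex ℝ s) (ht : Convex ℝ t) :
    Convex ℝ (s ×ℂ t) :=
  (hs.linear_preimage Complex.reLm).inter (ht.linear_preimage Complex.imLm)

theorem exists_kernel_primitive (n N : ℕ) : ∃ g G : ℂ → ℂ,
    (∀ z ∈ cutDomain N, HasDerivAt G (g z) z) ∧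
    ∀ z ∈ cutDomain N \ poles N,
      kernel n z = g z + ∑ w ∈ poles N, kernelResidue n w * (z - w)⁻¹ := by
  obtain ⟨g, hg, h⟩ := exists_principalPart_decomposition (isOpen_cutDomain N) (kernelResidue n)
    (poles N) (kernel n) (differentiableOn_kernel n N) (poles_subset_cutDomain N)
    fun w hw => tendsto_sub_mul_kernel n hw
  obtain ⟨G, hG⟩ := exists_primitive_of_starConvex (isOpen_cutDomain N) (starConvex_cutDomain N) hg
  exact ⟨g, G, hG, h⟩

/-! ### Estimates along the square and the tails -/

/-- Half the side length of the square which meets the imaginary axis halfway between poles. -/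
noncomputable def halfSide (N : ℕ) : ℝ := Real.pi * (N + 1 / 2)

theorem one_le_halfSide (N : ℕ) : 1 ≤ halfSide N := by
  have := Real.pi_gt_three
  have : (0 : ℝ) ≤ N := N.cast_nonneg
  rw [halfSide]
  nlinarith

theorem halfSide_lt (N : ℕ) : halfSide N < Real.pi * (N + 1) := by
  have := Real.pi_pos
  rw [halfSide]
  nlinarith

theorem abs_im_lt_halfSide {N : ℕ} {w : ℂ} (hw : w ∈ poles N) : |w.im| < halfSide N := by
  refine (abs_im_le_of_mem_poles hw).trans_lt ?_
  have := Real.pi_pos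
  rw [halfSide]
  nlinarith

theorem cos_halfSide (N : ℕ) : Real.cos (halfSide N) = 0 := by
  rw [Real.cos_eq_zero_iff]
  exact ⟨N, by rw [halfSide]; push_cast; ring⟩

section Estimates

variable {n N : ℕ} {F : ℂ → ℂ} {σ : ℝ}

theorem norm_sub_le_on_horizontal_side (hn : 1 ≤ n)
    (hF : ∀ z ∈ cutDomain N, (∀ w ∈ poles N, z - w ∈ Complex.slitPlane) →
      HasDerivAt F (kernel n z) z) (hσ : |σ| = 1) :
    ‖F ⟨-halfSide N, σ * halfSide N⟩ - F ⟨halfSide N, σ * halfSide N⟩‖ ≤ 16 / halfSide N := by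
  have hR := one_le_halfSide N
  have hlt := halfSide_lt N
  have hw := @abs_im_lt_halfSide N
  have hcos : Real.cos (σ * halfSide N) = 0 := by
    rw [← Real.cos_abs, abs_mul, hσ, one_mul, Real.cos_abs, cos_halfSide]
  set R := halfSide N
  have hRpos : 0 < R := by linarith
  have habs : |σ * R| = R := by rw [abs_mul, hσ, one_mul, abs_of_pos hRpos]
  have key := Convex.norm_image_sub_le_of_norm_hasDerivWithin_le (f := F) (f' := kernel n)
    (s := Icc (-R) R ×ℂ {σ * R}) (C := 8 / R ^ 2) (x := ⟨R, σ * R⟩) (y := ⟨-R, σ * R⟩)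
    (fun z hz => ?_) (fun z hz => ?_) (Convex.reProdIm (convex_Icc _ _) (convex_singleton _)) ?_ ?_
  · refine key.trans ?_
    have h1 : ‖(⟨-R, σ * R⟩ : ℂ) - ⟨R, σ * R⟩‖ ≤ 2 * R := by
      refine (Complex.norm_le_abs_re_add_abs_im _).trans ?_
      simp only [Complex.sub_re, Complex.sub_im, sub_self, abs_zero, add_zero]
      rw [abs_le]; constructor <;> linarith
    calc 8 / R ^ 2 * _ ≤ 8 / R ^ 2 * (2 * R) := by gcongr
      _ = 16 / R := by field_simp; norm_num
  · have him : z.im = σ * R := hz.2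
    refine (hF z ⟨fun h => ?_, ?_⟩ fun w hwN => ?_).hasDerivWithinAt
    · rw [← him, h.2, abs_zero] at habs
      linarith
    · rw [him, habs]
      linarith [le_max_left 0 z.re]
    · refine Complex.mem_slitPlane_iff.2 (Or.inr fun h => ?_)
      rw [Complex.sub_im, sub_eq_zero, him] at h
      have := hw hwN
      rw [← h, habs] at this
      exact lt_irrefl _ this
  · have him : z.im = σ * R := hz.2
    refine norm_kernel_le hn hR ?_ (one_le_norm_sinh_of_cos_im_eq_zero (him ▸ hcos))
    rw [← habs, ← him]
    exact Complex.abs_im_le_norm z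
  · exact ⟨⟨by simp; linarith, le_rfl⟩, rfl⟩
  · exact ⟨⟨le_rfl, by simp; linarith⟩, rfl⟩

/-- The cuts of `log (z - w)` run leftwards from the poles and cross this side. Those of `log (-(z -
w))` run rightwards and miss it, hence the changed hypothesis on `F`. -/
theorem norm_sub_le_on_left_side (hn : 1 ≤ n)
    (hF : ∀ z ∈ cutDomain N, (∀ w ∈ poles N, -(z - w) ∈ Complex.slitPlane) →
      HasDerivAt F (kernel n z) z) :
    ‖F ⟨-halfSide N, -halfSide N⟩ - F ⟨-halfSide N, halfSide N⟩‖ ≤ 16 / halfSide N := by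
  have hR := one_le_halfSide N
  have hlt := halfSide_lt N
  set R := halfSide N
  have hRpos : 0 < R := by linarith
  have key := Convex.norm_image_sub_le_of_norm_hasDerivWithin_le (f := F) (f' := kernel n)
    (s := {-R} ×ℂ Icc (-R) R) (C := 8 / R ^ 2) (x := ⟨-R, R⟩) (y := ⟨-R, -R⟩)
    (fun z hz => ?_) (fun z hz => ?_) (Convex.reProdIm (convex_singleton _) (convex_Icc _ _)) ?_ ?_
  · refine key.trans ?_
    have h1 : ‖(⟨-R, -R⟩ : ℂ) - ⟨-R, R⟩‖ ≤ 2 * R := by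
      refine (Complex.norm_le_abs_re_add_abs_im _).trans ?_
      simp only [Complex.sub_re, Complex.sub_im, sub_self, abs_zero, zero_add]
      rw [abs_le]; constructor <;> linarith
    calc 8 / R ^ 2 * _ ≤ 8 / R ^ 2 * (2 * R) := by gcongr
      _ = 16 / R := by field_simp; norm_num
  · have hre : z.re = -R := hz.1
    have him : |z.im| ≤ R := abs_le.2 hz.2
    refine (hF z ⟨fun h => by linarith [h.1], ?_⟩ fun w hwN => ?_).hasDerivWithinAt
    · linarith [le_max_left 0 z.re]
    · refine Complex.mem_slitPlane_iff.2 (Or.inl ?_)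
      rw [Complex.neg_re, Complex.sub_re, re_of_mem_poles hwN, hre]
      linarith
  · have hre : |z.re| = R := by rw [show z.re = -R from hz.1, abs_neg, abs_of_pos hRpos]
    refine norm_kernel_le hn hR (hre ▸ Complex.abs_re_le_norm z)
      (one_le_norm_sinh_of_one_le_abs_re (hre ▸ hR))
  · exact ⟨rfl, by simp; linarith, le_rfl⟩
  · exact ⟨rfl, le_rfl, by simp; linarith⟩

theorem mem_cutDomain_of_im_le_re {z : ℂ} (h1 : 0 < |z.im|) (h2 : |z.im| ≤ z.re) :
    z ∈ cutDomain N := by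
  refine ⟨fun h => ?_, ?_⟩
  · simp [h.2] at h1
  · have := Real.pi_pos
    have : (0 : ℝ) ≤ N := N.cast_nonneg
    have : 0 < Real.pi * (N + 1) := by positivity
    linarith [le_max_right 0 z.re]

theorem sub_mem_slitPlane_of_re_pos {z w : ℂ} (hz : 0 < z.re) (hw : w ∈ poles N) :
    z - w ∈ Complex.slitPlane := by
  refine Complex.mem_slitPlane_iff.2 (Or.inl ?_)
  rw [Complex.sub_re, re_of_mem_poles hw]
  linarith

theorem norm_sub_le_on_vertical_leg (hn : 1 ≤ n)
    (hF : ∀ z ∈ cutDomain N, (∀ w ∈ poles N, z - w ∈ Complex.slitPlane) →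
      HasDerivAt F (kernel n z) z) (hσ : |σ| = 1) {z : ℂ} (hz1 : 1 ≤ z.re)
    (hz : 0 < σ * z.im) (hz2 : σ * z.im ≤ z.re) :
    ‖F z - F ⟨z.re, σ * z.re⟩‖ ≤ 8 / z.re := by
  have hσ2 : σ * σ = 1 := by rw [← abs_mul_abs_self, hσ, one_mul]
  set x := z.re with hx
  have hconv : Convex ℝ ({u : ℂ | u.re = x} ∩ {u : ℂ | 0 < σ * u.im} ∩ {u : ℂ | σ * u.im ≤ x}) := by
    intro u hu v hv a b ha hb hab
    obtain ⟨⟨hu1, hu2⟩, hu3⟩ := hu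
    obtain ⟨⟨hv1, hv2⟩, hv3⟩ := hv
    simp only [mem_ofPred_eq] at *
    have hre : (a • u + b • v).re = a * u.re + b * v.re := by simp
    have him : σ * (a • u + b • v).im = a * (σ * u.im) + b * (σ * v.im) := by simp; ring
    refine ⟨⟨?_, ?_⟩, ?_⟩ <;> simp only [mem_ofPred_eq]
    · rw [hre, hu1, hv1, ← add_mul, hab, one_mul]
    · rw [him]
      exact (convex_Ioi (0 : ℝ)) hu2 hv2 ha hb hab
    · rw [him]
      exact (convex_Iic x) hu3 hv3 ha hb hab
  have hmem : ∀ u : ℂ, u.re = x → 0 < σ * u.im → σ * u.im ≤ x →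
      0 < |u.im| ∧ |u.im| ≤ u.re := by
    intro u h1 h2 h3
    have : |u.im| = σ * u.im := by rw [← abs_of_pos h2, abs_mul, hσ, one_mul]
    rw [this, h1]
    exact ⟨h2, h3⟩
  have hcorner : σ * (σ * x) = x := by rw [← mul_assoc, hσ2, one_mul]
  have key := Convex.norm_image_sub_le_of_norm_hasDerivWithin_le (f := F) (f' := kernel n)
    (s := {u : ℂ | u.re = x} ∩ {u : ℂ | 0 < σ * u.im} ∩ {u : ℂ | σ * u.im ≤ x})
    (C := 8 / x ^ 2) (x := ⟨x, σ * x⟩) (y := z)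
    (fun u hu => ?_) (fun u hu => ?_) hconv ?_ ?_
  · refine key.trans ?_
    have h1 : ‖z - ⟨x, σ * x⟩‖ ≤ x := by
      refine (Complex.norm_le_abs_re_add_abs_im _).trans ?_
      simp only [Complex.sub_re, Complex.sub_im, ← hx, sub_self, abs_zero, zero_add]
      have : |z.im - σ * x| = |σ * z.im - x| := by
        rw [← one_mul |z.im - σ * x|, ← hσ, ← abs_mul, mul_sub, hcorner]
      rw [this, abs_le]
      constructor <;> linarith
    calc 8 / x ^ 2 * _ ≤ 8 / x ^ 2 * x := by gcongr
      _ = 8 / x := by field_simp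
  · obtain ⟨⟨h1, h2⟩, h3⟩ := hu
    have h4 := hmem u h1 h2 h3
    exact (hF u (mem_cutDomain_of_im_le_re h4.1 h4.2) fun w hw =>
      sub_mem_slitPlane_of_re_pos (h4.1.trans_le h4.2) hw).hasDerivWithinAt
  · have hre : |u.re| = x := by
      rw [show u.re = x from hu.1.1, abs_of_pos (by linarith)]
    exact norm_kernel_le hn hz1 (hre ▸ Complex.abs_re_le_norm u)
      (one_le_norm_sinh_of_one_le_abs_re (hre ▸ hz1))
  · exact ⟨⟨rfl, by simp only [mem_ofPred_eq, hcorner]; linarith⟩, hcorner.le⟩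
  · exact ⟨⟨rfl, hz⟩, hz2⟩

theorem norm_sub_le_on_diagonal (hn : 1 ≤ n)
    (hF : ∀ z ∈ cutDomain N, (∀ w ∈ poles N, z - w ∈ Complex.slitPlane) →
      HasDerivAt F (kernel n z) z) (hσ : |σ| = 1) {a b : ℝ} (ha : 1 ≤ a) (hab : a ≤ b) :
    ‖F ⟨b, σ * b⟩ - F ⟨a, σ * a⟩‖ ≤ 16 / a := by
  have hmk : ∀ s : ℝ, (⟨s, σ * s⟩ : ℂ) = s * (1 + σ * Complex.I) := fun s => by
    apply Complex.ext <;> simp [mul_comm]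
  have hd : ∀ s ∈ Icc a b, HasDerivAt (fun s : ℝ => F ⟨s, σ * s⟩ - F ⟨a, σ * a⟩)
      (kernel n ⟨s, σ * s⟩ * (1 + σ * Complex.I)) s := by
    intro s hs
    have hs1 : 0 < s := by linarith [hs.1]
    have habs : |σ * s| = s := by rw [abs_mul, hσ, one_mul, abs_of_pos hs1]
    have h1 : HasDerivAt F (kernel n ⟨s, σ * s⟩) ⟨s, σ * s⟩ :=
      hF _ (mem_cutDomain_of_im_le_re (by simpa only [habs] using hs1) (by simp only [habs, le_refl]))
        fun w hw => sub_mem_slitPlane_of_re_pos hs1 hw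
    have h2 : HasDerivAt (fun s : ℝ => (⟨s, σ * s⟩ : ℂ)) (1 + σ * Complex.I) s := by
      simp only [hmk]
      simpa using (Complex.ofRealCLM.hasDerivAt (x := s)).mul_const (1 + σ * Complex.I)
    exact (h1.comp s h2).sub_const _
  -- A sup bound times length would not be uniform in `b`; instead `16 / s ^ 2`, a bound for the
  -- speed, is integrated from `a`.
  have hB : ∀ s ∈ Icc a b, HasDerivAt (fun s : ℝ => 16 * (a⁻¹ - s⁻¹)) (16 / s ^ 2) s := by
    intro s hs
    have hs1 : s ≠ 0 := by linarith [hs.1]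
    refine (((hasDerivAt_inv hs1).const_sub a⁻¹).const_mul 16).congr_deriv ?_
    field_simp
  have key := image_norm_le_of_norm_deriv_right_le_deriv_boundary'
    (f := fun s : ℝ => F ⟨s, σ * s⟩ - F ⟨a, σ * a⟩) (a := a) (b := b)
    (B := fun s : ℝ => 16 * (a⁻¹ - s⁻¹))
    (fun s hs => (hd s hs).continuousAt.continuousWithinAt)
    (fun s hs => (hd s (Ico_subset_Icc_self hs)).hasDerivWithinAt) (by simp)
    (fun s hs => (hB s hs).continuousAt.continuousWithinAt)
    (fun s hs => (hB s (Ico_subset_Icc_self hs)).hasDerivWithinAt)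
    (fun s hs => ?_) (right_mem_Icc.2 hab)
  · refine key.trans ?_
    have : 0 < b⁻¹ := inv_pos.2 (by linarith)
    rw [div_eq_mul_inv]
    linarith
  · have hs1 : 1 ≤ s := ha.trans hs.1
    have hre : |(⟨s, σ * s⟩ : ℂ).re| = s := abs_of_pos (by linarith)
    have h1 : ‖kernel n ⟨s, σ * s⟩‖ ≤ 8 / s ^ 2 :=
      norm_kernel_le hn hs1 (hre.symm.le.trans (Complex.abs_re_le_norm _))
        (one_le_norm_sinh_of_one_le_abs_re (hs1.trans hre.symm.le))
    have h2 : ‖(1 + σ * Complex.I : ℂ)‖ ≤ 2 := by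
      refine (Complex.norm_le_abs_re_add_abs_im _).trans ?_
      simp [hσ]
      norm_num
    rw [norm_mul]
    calc _ ≤ 8 / s ^ 2 * 2 := by gcongr
      _ = 16 / s ^ 2 := by ring

/-- From `z` vertically to the diagonal, then along it to the corner. The bound is uniform in `z`,
although `im z` may be unbounded along the tail. -/
theorem norm_sub_corner_le (hn : 1 ≤ n)
    (hF : ∀ z ∈ cutDomain N, (∀ w ∈ poles N, z - w ∈ Complex.slitPlane) →
      HasDerivAt F (kernel n z) z) (hσ : |σ| = 1) {z : ℂ} (hz1 : halfSide N ≤ z.re)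
    (hz : 0 < σ * z.im) (hz2 : σ * z.im ≤ z.re) :
    ‖F z - F ⟨halfSide N, σ * halfSide N⟩‖ ≤ 24 / halfSide N := by
  have hR := one_le_halfSide N
  have h1 := norm_sub_le_on_vertical_leg hn hF hσ (hR.trans hz1) hz hz2
  have h2 := norm_sub_le_on_diagonal hn hF hσ hR hz1
  have h3 : 8 / z.re ≤ 8 / halfSide N := by gcongr
  have h4 := norm_sub_le_norm_sub_add_norm_sub (F z) (F ⟨z.re, σ * z.re⟩)
    (F ⟨halfSide N, σ * halfSide N⟩)
  have h5 : 24 / halfSide N = 8 / halfSide N + 16 / halfSide N := by ring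
  linarith

end Estimates

/-! ### Comparison of the contour with the square -/

theorem norm_integral_add_residues_le {n : ℕ} (hn : 1 ≤ n) {γ : ℝ → ℂ} (hγ : IsHankelContour γ)
    {N : ℕ} (hpoles : ∀ w ∈ poles N, NotEncloses γ w) (hγU : ∀ t, γ t ∈ cutDomain N) :
    (∀ a b : ℝ, IntervalIntegrable (fun t => kernel n (γ t) * deriv γ t) volume a b) ∧
      ∀ᶠ p : ℝ × ℝ in atBot ×ˢ atTop,
        ‖(∫ t in p.1..p.2, kernel n (γ t) * deriv γ t) +
          2 * Real.pi * Complex.I * ∑ w ∈ poles N, kernelResidue n w‖ ≤ 96 / halfSide N := by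
  obtain ⟨g, G, hG, hfg⟩ := exists_kernel_primitive n N
  choose! ℓ hℓc hℓe hℓbot hℓtop using fun w hw => (hpoles w hw).exists_log hγ.piecewiseC1.1
  have hint := hγ.piecewiseC1.integral_eq_sub (isOpen_cutDomain N) hγU
    (differentiableOn_kernel n N) hG hfg hℓc hℓe
  refine ⟨fun a b => (hint a b).1, ?_⟩
  set ρ := ∑ w ∈ poles N, kernelResidue n w with hρ
  set R := halfSide N with hRdef
  have hR : 1 ≤ R := one_le_halfSide N
  let F : ℂ → ℂ := fun z => G z + ∑ w ∈ poles N, kernelResidue n w * Complex.log (z - w)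
  let F' : ℂ → ℂ := fun z => G z + ∑ w ∈ poles N, kernelResidue n w * Complex.log (-(z - w))
  have hF : ∀ z ∈ cutDomain N, (∀ w ∈ poles N, z - w ∈ Complex.slitPlane) →
      HasDerivAt F (kernel n z) z := by
    intro z hz hs
    have hzK : z ∉ poles N := fun h => Complex.slitPlane_ne_zero (hs z h) (sub_self z)
    rw [hfg z ⟨hz, hzK⟩]
    refine (hG z hz).add (HasDerivAt.fun_sum fun w hw => HasDerivAt.const_mul _ ?_)
    simpa using ((hasDerivAt_id z).sub_const w).clog (hs w hw)
  have hF' : ∀ z ∈ cutDomain N, (∀ w ∈ poles N, -(z - w) ∈ Complex.slitPlane) →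
      HasDerivAt F' (kernel n z) z := by
    intro z hz hs
    have hzK : z ∉ poles N := fun h => Complex.slitPlane_ne_zero (hs z h) (by simp)
    rw [hfg z ⟨hz, hzK⟩]
    refine (hG z hz).add (HasDerivAt.fun_sum fun w hw => HasDerivAt.const_mul _ ?_)
    refine (((hasDerivAt_id z).sub_const w).fun_neg.clog (hs w hw)).congr_deriv ?_
    change -1 / -(z - w) = (z - w)⁻¹
    rw [neg_div_neg_eq, one_div]
  -- All poles lie strictly between the heights `-R` and `R`, so switching branch costs the same
  -- `πi` for every pole, with opposite signs at the two left corners. The total jump is `2πi ρ`.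
  have htop : F' ⟨-R, R⟩ = F ⟨-R, R⟩ - Real.pi * Complex.I * ρ := by
    simp only [F, F', hρ, Finset.mul_sum, add_sub_assoc, ← Finset.sum_sub_distrib]
    congr 1
    refine Finset.sum_congr rfl fun w hw => ?_
    rw [Complex.log_neg_of_im_pos]
    · ring
    · have := (abs_lt.1 (abs_im_lt_halfSide hw)).2
      simp only [Complex.sub_im]
      linarith
  have hbot : F' ⟨-R, -R⟩ = F ⟨-R, -R⟩ + Real.pi * Complex.I * ρ := by
    simp only [F, F', hρ, Finset.mul_sum, add_assoc, ← Finset.sum_add_distrib]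
    congr 1
    refine Finset.sum_congr rfl fun w hw => ?_
    rw [Complex.log_neg_of_im_neg]
    · ring
    · have := (abs_lt.1 (abs_im_lt_halfSide hw)).1
      simp only [Complex.sub_im]
      linarith
  have e1 := norm_sub_le_on_horizontal_side hn hF (σ := 1) abs_one
  have e2 := norm_sub_le_on_horizontal_side hn hF (σ := -1) (by simp)
  have e3 := norm_sub_le_on_left_side hn hF'
  rw [← hRdef, one_mul] at e1
  rw [← hRdef, neg_one_mul] at e2
  rw [← hRdef, htop, hbot] at e3
  have hstart : ∀ᶠ t in atBot, ‖F (γ t) - F ⟨R, R⟩‖ ≤ 24 / R := by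
    filter_upwards [hγ.re_start.eventually_ge_atTop R, hγ.start_above,
      hγ.slope_start.eventually_lt_const one_pos] with t h1 h2 h3
    rw [div_lt_one (by linarith)] at h3
    simpa using norm_sub_corner_le hn hF (σ := 1) abs_one h1 (by linarith) (by linarith)
  have hfinish : ∀ᶠ t in atTop, ‖F (γ t) - F ⟨R, -R⟩‖ ≤ 24 / R := by
    filter_upwards [hγ.re_finish.eventually_ge_atTop R, hγ.finish_below,
      hγ.slope_finish.eventually_const_lt (neg_one_lt_zero)] with t h1 h2 h3
    rw [lt_div_iff₀ (by linarith)] at h3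
    simpa using norm_sub_corner_le hn hF (σ := -1) (by simp) h1 (by linarith) (by linarith)
  have hlbot : ∀ᶠ t in atBot, ∀ w ∈ poles N, ℓ w t = Complex.log (γ t - w) :=
    (eventually_all_finset _).2 hℓbot
  have hltop : ∀ᶠ t in atTop, ∀ w ∈ poles N, ℓ w t = Complex.log (γ t - w) :=
    (eventually_all_finset _).2 hℓtop
  filter_upwards [(hstart.and hlbot).prod_mk (hfinish.and hltop)] with p hp
  obtain ⟨⟨e4, l4⟩, e5, l5⟩ := hp
  have hI : (∫ t in p.1..p.2, kernel n (γ t) * deriv γ t) = F (γ p.2) - F (γ p.1) := by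
    have s4 : ∑ w ∈ poles N, kernelResidue n w * ℓ w p.1 =
        ∑ w ∈ poles N, kernelResidue n w * Complex.log (γ p.1 - w) :=
      Finset.sum_congr rfl fun w hw => by rw [l4 w hw]
    have s5 : ∑ w ∈ poles N, kernelResidue n w * ℓ w p.2 =
        ∑ w ∈ poles N, kernelResidue n w * Complex.log (γ p.2 - w) :=
      Finset.sum_congr rfl fun w hw => by rw [l5 w hw]
    rw [(hint p.1 p.2).2, s4, s5]
  rw [hI]
  -- Telescoping between the ends of `γ` by way of the four corners; the left side carries both
  -- half-jumps.
  have hsum : F (γ p.2) - F (γ p.1) + 2 * Real.pi * Complex.I * ρ =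
      (F (γ p.2) - F ⟨R, -R⟩) - (F ⟨-R, -R⟩ - F ⟨R, -R⟩) +
      (F ⟨-R, -R⟩ + Real.pi * Complex.I * ρ - (F ⟨-R, R⟩ - Real.pi * Complex.I * ρ)) +
      (F ⟨-R, R⟩ - F ⟨R, R⟩) - (F (γ p.1) - F ⟨R, R⟩) := by ring
  rw [hsum]
  have hfinal : 96 / R = 24 / R + 16 / R + 16 / R + 16 / R + 24 / R := by ring
  rw [hfinal]
  exact norm_sub_le_of_le (norm_add_le_of_le (norm_add_le_of_le (norm_sub_le_of_le e5 e2) e3) e1) e4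

/-- The tails satisfy `|im| < re`, which the term `max 0 z.re` in `cutDomain` admits; the compact
remainder is bounded. -/
theorem IsHankelContour.eventually_mem_cutDomain {γ : ℝ → ℂ} (hγ : IsHankelContour γ) :
    ∀ᶠ N : ℕ in atTop, ∀ t, γ t ∈ cutDomain N := by
  have htail : ∀ z : ℂ, 1 ≤ z.re → |z.im / z.re| < 1 → |z.im| < z.re := fun z h1 h2 => by
    rwa [abs_div, abs_of_pos (show 0 < z.re by linarith), div_lt_one (by linarith)] at h2
  have h0 : Ioo (-1 : ℝ) 1 ∈ 𝓝 (0 : ℝ) := Ioo_mem_nhds (by norm_num) (by norm_num)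
  obtain ⟨a, ha⟩ := eventually_atBot.1
    ((hγ.re_start.eventually_ge_atTop 1).and (hγ.slope_start.eventually_mem h0))
  obtain ⟨b, hb⟩ := eventually_atTop.1
    ((hγ.re_finish.eventually_ge_atTop 1).and (hγ.slope_finish.eventually_mem h0))
  obtain ⟨C, hC⟩ := (isCompact_Icc (a := a) (b := b)).exists_bound_of_continuousOn
    hγ.piecewiseC1.1.continuousOn
  filter_upwards [eventually_ge_atTop ⌈C⌉₊] with N hN t
  refine ⟨hγ.avoids_cut t, ?_⟩
  have hN0 : (0 : ℝ) ≤ N := N.cast_nonneg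
  have hpi := Real.pi_gt_three
  have hN1 : (N : ℝ) + 1 ≤ Real.pi * (N + 1) := by nlinarith
  by_cases h1 : t ≤ a
  · have := htail _ (ha t h1).1 (abs_lt.2 (ha t h1).2)
    linarith [le_max_right 0 (γ t).re]
  by_cases h2 : b ≤ t
  · have := htail _ (hb t h2).1 (abs_lt.2 (hb t h2).2)
    linarith [le_max_right 0 (γ t).re]
  · have h3 := hC t ⟨by linarith, by linarith⟩
    have h4 : C ≤ N := (Nat.le_ceil C).trans (by exact_mod_cast hN)
    linarith [Complex.abs_im_le_norm (γ t), le_max_left 0 (γ t).re]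

/-! ### The sum of the residues -/

theorem sum_poles (h : ℂ → ℂ) (N : ℕ) :
    ∑ w ∈ poles N, h w = ∑ k ∈ Finset.range N,
      (h (((k + 1 : ℕ) : ℂ) * Real.pi * Complex.I) +
        h (-(((k + 1 : ℕ) : ℂ) * Real.pi * Complex.I))) := by
  rw [poles, Finset.sum_image]
  · induction N with
    | zero => simp
    | succ N ih =>
      have hs : (Finset.Icc (-((N + 1 : ℕ) : ℤ)) ((N + 1 : ℕ) : ℤ)).erase 0 =
          insert ((N + 1 : ℕ) : ℤ) (insert (-((N + 1 : ℕ) : ℤ))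
            ((Finset.Icc (-(N : ℤ)) N).erase 0)) := by
        ext m
        simp only [Finset.mem_erase, Finset.mem_Icc, Finset.mem_insert]
        omega
      rw [hs, Finset.sum_insert, Finset.sum_insert, ih, Finset.sum_range_succ]
      · push_cast
        simp only [neg_mul]
        ring
      · simp only [Finset.mem_erase, Finset.mem_Icc]
        omega
      · simp only [Finset.mem_erase, Finset.mem_Icc, Finset.mem_insert]
        omega
  · intro a _ b _ hab
    simpa [Real.pi_ne_zero] using hab

/-- The power is odd and `cosh` even, so the sum is governed by the difference of the logarithms:
arguments `π/2` and `3π/2`, hence `-πi`. -/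
theorem kernelResidue_add_kernelResidue_neg (n k : ℕ) (hk : 0 < k) :
    kernelResidue n (k * Real.pi * Complex.I) + kernelResidue n (-(k * Real.pi * Complex.I)) =
      -(-1) ^ n / Real.pi ^ (2 * n) * ((-1) ^ k / (k : ℂ) ^ (2 * n + 1)) := by
  set w : ℂ := k * Real.pi * Complex.I with hw
  have him : 0 < w.im := by simp [hw]; positivity
  have hcosh : Complex.cosh w = (-1) ^ k := by
    rw [hw, Complex.cosh_mul_I]
    exact_mod_cast congrArg Complex.ofReal (Real.cos_nat_mul_pi k)
  have hlog : cutLog w - cutLog (-w) = -(Real.pi * Complex.I) := by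
    rw [cutLog, cutLog, neg_neg, Complex.log_neg_of_im_pos him]
    ring
  have hodd : (-w) ^ (2 * n + 1) = -w ^ (2 * n + 1) := Odd.neg_pow ⟨n, rfl⟩ w
  have hk0 : (k : ℂ) ≠ 0 := by exact_mod_cast hk.ne'
  have hpi : (Real.pi : ℂ) ≠ 0 := by exact_mod_cast Real.pi_ne_zero
  have hpow : w ^ (2 * n + 1) =
      (k : ℂ) ^ (2 * n + 1) * Real.pi ^ (2 * n) * Real.pi * ((-1) ^ n * Complex.I) := by
    rw [hw, mul_pow, mul_pow, pow_succ Complex.I, pow_mul Complex.I, Complex.I_sq,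
      pow_succ (Real.pi : ℂ)]
    ring
  have hsum : kernelResidue n w + kernelResidue n (-w) =
      (cutLog w - cutLog (-w)) / (w ^ (2 * n + 1) * Complex.cosh w) := by
    rw [kernelResidue, kernelResidue, hodd, Complex.cosh_neg, neg_mul, div_neg]
    ring
  have h1 : ∀ j : ℕ, ((-1 : ℂ) ^ j)⁻¹ = (-1) ^ j := fun j => by rw [← inv_pow]; norm_num
  rw [hsum, hlog, hcosh, hpow]
  simp only [div_eq_mul_inv, mul_inv, h1]
  field_simp

/-- The alternating series is twice its even part minus the full series. The term `k = 0` vanishes,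
since `1 / 0 = 0`. -/
theorem hasSum_alternating_zeta {s : ℕ} (hs : 1 < s) :
    HasSum (fun k : ℕ => (-1 : ℂ) ^ k / (k : ℂ) ^ s)
      ((2 * (1 / 2 ^ s) - 1) * riemannZeta s) := by
  have hsum : Summable fun k : ℕ => 1 / (k : ℂ) ^ s := by
    refine Summable.of_norm ?_
    simpa using Real.summable_one_div_nat_pow.2 hs
  have h1 : HasSum (fun k : ℕ => 1 / (k : ℂ) ^ s) (riemannZeta s) := by
    rw [zeta_nat_eq_tsum_of_gt_one hs]
    exact hsum.hasSum
  have h2 : HasSum (fun k : ℕ => if Even k then 1 / (k : ℂ) ^ s else 0)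
      (1 / 2 ^ s * riemannZeta s) := by
    have hinj : Function.Injective fun k : ℕ => 2 * k := fun a b h => by simpa using h
    rw [← hinj.hasSum_iff]
    · refine (h1.mul_left (1 / 2 ^ s)).congr_fun fun k => ?_
      simp [mul_pow, mul_comm]
    · intro k hk
      rw [if_neg]
      rintro ⟨j, rfl⟩
      exact hk ⟨j, by ring⟩
  have h3 := (h2.mul_left 2).sub h1
  rw [sub_mul, one_mul, mul_assoc]
  refine h3.congr_fun fun k => ?_
  by_cases hk : Even k
  · rw [if_pos hk, hk.neg_one_pow]; ring
  · rw [if_neg hk, (Nat.not_even_iff_odd.1 hk).neg_one_pow]; ring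

theorem tendsto_sum_kernelResidue {n : ℕ} (hn : 1 ≤ n) :
    Tendsto (fun N => ∑ w ∈ poles N, kernelResidue n w) atTop
      (𝓝 (-(-1) ^ n / Real.pi ^ (2 * n) *
        ((2 * (1 / 2 ^ (2 * n + 1)) - 1) * riemannZeta (2 * n + 1)))) := by
  have h := hasSum_alternating_zeta (s := 2 * n + 1) (by omega)
  push_cast at h
  have h1 := (h.tendsto_sum_nat.comp (tendsto_add_atTop_nat 1)).const_mul
    (-(-1 : ℂ) ^ n / Real.pi ^ (2 * n))
  refine h1.congr fun N => ?_
  rw [sum_poles, Function.comp_apply, Finset.sum_range_succ']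
  simp only [kernelResidue_add_kernelResidue_neg n _ (Nat.succ_pos _)]
  simp [Finset.mul_sum]

end HankelZeta

theorem mainTheorem5 (n : ℕ) (hn : 1 ≤ n) (γ : ℝ → ℂ) (hγ : HankelZeta.IsHankelContour γ)
    (hpoles : ∀ m : ℤ, m ≠ 0 → HankelZeta.NotEncloses γ (m * Real.pi * Complex.I)) :
    ∃ J : ℂ,
      HankelZeta.HasContourIntegral
        (fun z => HankelZeta.cutLog z / (z ^ (2 * n + 1) * Complex.sinh z)) γ J ∧
      riemannZeta (2 * n + 1) =
        (-1) ^ (n + 1) * ((2 * Real.pi) ^ (2 * n) / (2 ^ (2 * n) - 1)) *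
          (1 / (2 * Real.pi * Complex.I) * J) := by
  have hp : ∀ N, ∀ w ∈ HankelZeta.poles N, HankelZeta.NotEncloses γ w := fun N w hw => by
    obtain ⟨m, hm, -, rfl⟩ := HankelZeta.mem_poles.1 hw
    exact hpoles m hm
  have hev : ∀ᶠ N in atTop, _ := hγ.eventually_mem_cutDomain.mono fun N hN =>
    HankelZeta.norm_integral_add_residues_le hn hγ (hp N) hN
  have hpi : (Real.pi : ℂ) ≠ 0 := by exact_mod_cast Real.pi_ne_zero
  have hρ := HankelZeta.tendsto_sum_kernelResidue hn
  set ρ : ℂ := -(-1) ^ n / Real.pi ^ (2 * n) *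
    ((2 * (1 / 2 ^ (2 * n + 1)) - 1) * riemannZeta (2 * n + 1)) with hρdef
  refine ⟨-(2 * Real.pi * Complex.I * ρ), ⟨?_, ?_⟩, ?_⟩
  · obtain ⟨N, hN⟩ := hev.exists
    exact hN.1
  · have hlim := hρ.const_mul (2 * Real.pi * Complex.I : ℂ)
    have herr : Tendsto (fun N : ℕ => 96 / HankelZeta.halfSide N) atTop (𝓝 0) := by
      refine tendsto_const_nhds.div_atTop (Tendsto.const_mul_atTop Real.pi_pos ?_)
      exact tendsto_atTop_add_const_right _ _ tendsto_natCast_atTop_atTop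
    rw [Metric.tendsto_nhds]
    intro ε hε
    -- One `N` is fixed for the given `ε`, and only then do the end points tend to infinity.
    obtain ⟨N, hN, h1, h2⟩ := (hev.and ((Metric.tendsto_nhds.1 hlim (ε / 2) (by positivity)).and
      (herr.eventually_lt_const (half_pos hε)))).exists
    filter_upwards [hN.2] with p h3
    rw [dist_eq_norm] at h1 ⊢
    refine lt_of_le_of_lt (le_trans (le_of_eq (congrArg _ ?_)) (norm_sub_le _ _))
      (lt_of_lt_of_le (add_lt_add (lt_of_le_of_lt h3 h2) h1) (add_halves ε).le)
    simp only [HankelZeta.kernel]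
    ring
  · have h2 : (2 : ℂ) ^ (2 * n) - 1 ≠ 0 := by
      have : (2 : ℝ) ^ (2 * n) - 1 ≠ 0 := by
        have := one_lt_pow₀ (one_lt_two (α := ℝ)) (show 2 * n ≠ 0 by omega)
        linarith
      exact_mod_cast this
    have hsq : (-1 : ℂ) ^ n * (-1) ^ n = 1 := by rw [← mul_pow]; norm_num
    rw [hρdef, pow_succ (2 : ℂ), pow_succ (-1 : ℂ), mul_pow]
    field_simp
    linear_combination riemannZeta (2 * n + 1) * (1 - 2 ^ (2 * n)) * hsq
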